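/- Let $X_1,X_2,\dots$ be non-negative i.i.d. random variables with distribution function $F$, and let $V(t)=\inf\{x\ge 0:\ -1/\ln F(x)\ge t\}$ (with $-1/\ln 0=0$ and $-1/\ln 1=+\infty$). For integers $N\ge m^2$, $m\ge 2$, write $[\cdot]$ for the integer part, $L_{u,v}=\max\{X_u,\dots,X_v\}$, and put $$\hat\gamma^{(1)}_N(m)=\frac1{[N/m^2]}\sum_{i=1}^{[N/m^2]}\left\{\frac{\ln\Big(\sum_{j=(i-1)m^2+1}^{im^2}X_j^2\Big)}{2\ln m}-\frac1m\sum_{k=1}^m\frac{\ln\Big(\sum_{j=(i-1)m^2+(k-1)m+1}^{(i-1)m^2+km}X_j^2\Big)}{2\ln m}\right\},$$ $$\hat\gamma^{(2)}_N(m)=\frac1{[N/m^2]}\sum_{i=1}^{[N/m^2]}\left\{\frac{\ln L_{(i-1)m^2+1,\,im^2}}{\ln m}-\frac1m\sum_{k=1}^m\frac{\ln L_{(i-1)m^2+(k-1)m+1,\,(i-1)m^2+km}}{\ln m}\right\}.$$ Let $m=m(N)$ be a sequence of positive integers with $m(N)\to\infty$ and $N\ln^2 m/m^2\to\infty$ as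 $N\to\infty$, and with $m(N)^2\le N$ for all large $N$ (so that there is at least one block and the estimators are defined). Suppose that, for some $\gamma$, $\lim_{t\to\infty}V(tx)/V(t)=x^{\gamma}$ for all $x>0$. (i) If $\gamma>1/2$, $F$ has a bounded probability density $p$, and $p(x)/x$ is bounded in a neighbourhood of zero, then $\hat\gamma^{(1)}_N(m)\to\gamma$ in probability as $N\to\infty$. (ii) If $\gamma>0$ and $F(\delta)=0$ for some $\delta>0$, then $\hat\gamma^{(2)}_N(m)\to\gamma$ in probability as $N\to\infty$. -/

import Mathlib

open MeasureTheory ProbabilityTheory Filter Topology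

noncomputable section

namespace TailIndex

/-- The quantile function `V(t) = inf {x ≥ 0 : -1 / ln F(x) ≥ t}` of a distribution function `F`.
The value of `-1 / ln F(x)` is `+∞` where `F x = 1` (first alternative) and `0` where `F x = 0`
(which is what the real expression `-1 / Real.log 0` evaluates to). -/
def quantileV (F : ℝ → ℝ) (t : ℝ) : ℝ :=
  sInf {x : ℝ | 0 ≤ x ∧ (F x = 1 ∨ t ≤ -1 / Real.log (F x))}

/-- `V` varies regularly at infinity with index `γ`. -/
def RegularlyVarying (V : ℝ → ℝ) (γ : ℝ) : Prop :=
  ∀ x : ℝ, 0 < x → Tendsto (fun t : ℝ => V (t * x) / V t) atTop (𝓝 (x ^ γ))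

/-- The sum of the squares of the `l` consecutive observations `x s, …, x (s + l - 1)`. -/
def blockSumSq (x : ℕ → ℝ) (s l : ℕ) : ℝ :=
  ∑ j ∈ Finset.range l, x (s + j) ^ 2

/-- The maximum of the `l` consecutive observations `x s, …, x (s + l - 1)`. -/
def blockMax (x : ℕ → ℝ) (s l : ℕ) : ℝ :=
  ⨆ j : Fin l, x (s + j)

/-- The statistic of the `i`-th block of width `m ^ 2` (blocks, sub-blocks and observations are
counted from `0`), built from sums of squares over the block and over its `m` sub-blocks of
width `m`. -/
def xiSum (x : ℕ → ℝ) (m i : ℕ) : ℝ :=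
  Real.log (blockSumSq x (i * m ^ 2) (m ^ 2)) / (2 * Real.log m)
    - 1 / (m : ℝ) * ∑ k ∈ Finset.range m,
        Real.log (blockSumSq x (i * m ^ 2 + k * m) m) / (2 * Real.log m)

/-- The statistic of the `i`-th block of width `m ^ 2`, built from maxima over the block and over
its `m` sub-blocks of width `m`. -/
def xiMax (x : ℕ → ℝ) (m i : ℕ) : ℝ :=
  Real.log (blockMax x (i * m ^ 2) (m ^ 2)) / Real.log m
    - 1 / (m : ℝ) * ∑ k ∈ Finset.range m,
        Real.log (blockMax x (i * m ^ 2 + k * m) m) / Real.log m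

/-- The SRCEN estimator computed from the first `N` observations `x 0, …, x (N - 1)`;
`N / m ^ 2` in the natural numbers is the integer part, the number of complete blocks. -/
def srcenEstimator (x : ℕ → ℝ) (N m : ℕ) : ℝ :=
  1 / ((N / m ^ 2 : ℕ) : ℝ) * ∑ i ∈ Finset.range (N / m ^ 2), xiSum x m i

/-- The block-maxima estimator computed from the first `N` observations `x 0, …, x (N - 1)`. -/
def maxEstimator (x : ℕ → ℝ) (N m : ℕ) : ℝ :=
  1 / ((N / m ^ 2 : ℕ) : ℝ) * ∑ i ∈ Finset.range (N / m ^ 2), xiMax x m i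

/-- The law `ν` has a density `p` with respect to Lebesgue measure such that `p` is bounded and
`p(x) / x` is bounded in a neighbourhood of zero (on the positive side, where the non-negative
random variables of interest live). -/
def HasTameDensity (ν : Measure ℝ) : Prop :=
  ∃ p : ℝ → ℝ, Measurable p ∧ (∀ x, 0 ≤ p x) ∧
    ν = volume.withDensity (fun x => ENNReal.ofReal (p x)) ∧
    (∃ C : ℝ, ∀ x, p x ≤ C) ∧
    (∃ C ε : ℝ, 0 < ε ∧ ∀ x, 0 < x → x < ε → p x / x ≤ C)

end TailIndex

end

namespace TailIndex

/-! Both estimators come from a block statistic `Y` lying between the maximum of a block and its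
`ℓ^a`-norms for `a < 1 / γ`. For such `Y`, `log Y / log n → γ` in `L¹` as the block width `n` grows,
uniformly in the position of the block (`eventually_eLpNorm_log_div_log_sub_le`). Above `γ`, the
moment bound `E Y^a ≤ n E X^a` controls the excess. Below, the maximum stays under `n^(γ-ε)` with
probability `F(n^(γ-ε))^n → 0`, and the negative part of `log Y` is dominated by that of one
observation, which is integrable.

With normalisation `log m`, a block of width `m^2` contributes `2γ` and its sub-blocks contribute
`γ` on average, leaving `γ`. By Minkowski, averaging over blocks preserves the `L¹` bound, so
independence matters only inside a block.

The tail facts follow from `log V(t) / log t → γ`. -/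

theorem mem_quantileV_set_iff {p t : ℝ} (hp0 : 0 ≤ p) (hp1 : p ≤ 1) (ht : 0 < t) :
    (p = 1 ∨ t ≤ -1 / Real.log p) ↔ Real.exp (-1 / t) ≤ p := by
  rcases eq_or_lt_of_le hp1 with rfl | hlt
  · simp [div_nonpos_iff, ht.le]
  rcases eq_or_lt_of_le hp0 with rfl | hpos
  -- Since `Real.log 0 = 0`, the quotient is `0 < t`: both sides fail.
  · simp [ht.not_ge, (Real.exp_pos _).not_ge]
  have hlog : Real.log p < 0 := Real.log_neg hpos hlt
  rw [← Real.le_log_iff_exp_le hpos, or_iff_right hlt.ne, le_div_iff_of_neg hlog,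
    div_le_iff₀ ht, mul_comm]

/-! ### Quantile function and distribution function -/

section Quantile

variable (ν : Measure ℝ)

theorem quantileV_cdf_eq {t : ℝ} (ht : 0 < t) :
    quantileV (fun x => cdf ν x) t = sInf {x : ℝ | 0 ≤ x ∧ Real.exp (-1 / t) ≤ cdf ν x} := by
  simp only [quantileV, mem_quantileV_set_iff (cdf_nonneg ν _) (cdf_le_one ν _) ht]

theorem exp_neg_inv_lt_one {t : ℝ} (ht : 0 < t) : Real.exp (-1 / t) < 1 := by
  rw [Real.exp_lt_one_iff]
  exact div_neg_of_neg_of_pos (by norm_num) ht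

theorem quantileV_set_nonempty {t : ℝ} (ht : 0 < t) :
    {x : ℝ | 0 ≤ x ∧ Real.exp (-1 / t) ≤ cdf ν x}.Nonempty := by
  have h1 := (tendsto_cdf_atTop ν).eventually (lt_mem_nhds (exp_neg_inv_lt_one ht))
  obtain ⟨x, hx, hx0⟩ := (h1.and (eventually_ge_atTop 0)).exists
  exact ⟨x, hx0, hx.le⟩

theorem quantileV_set_bddBelow (t : ℝ) :
    BddBelow {x : ℝ | 0 ≤ x ∧ Real.exp (-1 / t) ≤ cdf ν x} :=
  ⟨0, fun _ hx => hx.1⟩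

theorem quantileV_nonneg (F : ℝ → ℝ) (t : ℝ) : 0 ≤ quantileV F t :=
  Real.sInf_nonneg fun _ hx => hx.1

theorem quantileV_monotoneOn : MonotoneOn (quantileV (fun x => cdf ν x)) (Set.Ioi 0) := by
  intro s hs t ht hst
  rw [quantileV_cdf_eq ν hs, quantileV_cdf_eq ν ht]
  refine csInf_le_csInf (quantileV_set_bddBelow ν s) (quantileV_set_nonempty ν ht) ?_
  rintro x ⟨hx0, hx⟩
  refine ⟨hx0, le_trans (Real.exp_le_exp.2 ?_) hx⟩
  rw [div_le_div_iff₀ hs ht]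
  linarith

theorem cdf_lt_of_lt_quantileV {t x : ℝ} (ht : 0 < t) (hx0 : 0 ≤ x)
    (hx : x < quantileV (fun x => cdf ν x) t) : cdf ν x < Real.exp (-1 / t) := by
  by_contra! h
  rw [quantileV_cdf_eq ν ht] at hx
  exact absurd (csInf_le (quantileV_set_bddBelow ν t) ⟨hx0, h⟩) (not_le.2 hx)

theorem exp_le_cdf_of_quantileV_lt {t x : ℝ} (ht : 0 < t)
    (hx : quantileV (fun x => cdf ν x) t < x) : Real.exp (-1 / t) ≤ cdf ν x := by
  rw [quantileV_cdf_eq ν ht] at hx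
  obtain ⟨y, hy, hyx⟩ := exists_lt_of_csInf_lt (quantileV_set_nonempty ν ht) hx
  exact hy.2.trans (monotone_cdf ν hyx.le)

end Quantile

/-- A monotone function varying regularly with index `γ` is of logarithmic order `γ`. -/
theorem RegularlyVarying.tendsto_log_div_log {V : ℝ → ℝ} {γ : ℝ} (hV : RegularlyVarying V γ)
    (hmono : MonotoneOn V (Set.Ioi 0)) (hnonneg : ∀ t, 0 ≤ V t) :
    Tendsto (fun t => Real.log (V t) / Real.log t) atTop (𝓝 γ) := by
  have hpos : ∀ᶠ t in atTop, 0 < V t := by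
    -- At `x = 1` the ratio `V t / V t` tends to `1`, which excludes `V t = 0` because `0 / 0 = 0`.
    have h1 := hV 1 one_pos
    rw [Real.one_rpow] at h1
    filter_upwards [h1.eventually (lt_mem_nhds (show (0 : ℝ) < 1 by norm_num))] with t ht
    refine lt_of_le_of_ne (hnonneg t) fun h => ?_
    rw [← h, div_zero] at ht
    exact lt_irrefl _ ht
  -- Sampled at `exp n`, `log V` has increments tending to `log (e^γ) = γ`. Cesàro gives the limit
  -- along integers, and monotonicity fills the gaps by floor and ceiling.
  set u : ℕ → ℝ := fun n => Real.log (V (Real.exp n)) with hu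
  have hexp : Tendsto (fun n : ℕ => Real.exp n) atTop atTop :=
    Real.tendsto_exp_atTop.comp tendsto_natCast_atTop_atTop
  have hstep : Tendsto (fun n : ℕ => u (n + 1) - u n) atTop (𝓝 γ) := by
    have h1 := ((hV (Real.exp 1) (Real.exp_pos 1)).comp hexp).log
      (Real.rpow_pos_of_pos (Real.exp_pos 1) γ).ne'
    rw [Real.log_rpow (Real.exp_pos 1), Real.log_exp, mul_one] at h1
    refine h1.congr' ?_
    have hexp' : Tendsto (fun n : ℕ => Real.exp ((n + 1 : ℕ) : ℝ)) atTop atTop :=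
      hexp.comp (tendsto_add_atTop_nat 1)
    filter_upwards [hexp.eventually hpos, hexp'.eventually hpos] with n hn hn'
    simp only [hu, Function.comp]
    rw [← Real.exp_add]
    push_cast at hn' ⊢
    rw [Real.log_div hn'.ne' hn.ne']
  have hces : Tendsto (fun n : ℕ => u n / n) atTop (𝓝 γ) := by
    have h1 := hstep.cesaro
    simp only [Finset.sum_range_sub] at h1
    have h2 : Tendsto (fun n : ℕ => (n : ℝ)⁻¹ * u 0) atTop (𝓝 (0 * u 0)) :=
      tendsto_inv_atTop_nhds_zero_nat.mul_const _
    have h3 := h1.add h2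
    rw [zero_mul, add_zero] at h3
    refine h3.congr fun n => ?_
    ring
  have key : Tendsto (fun s : ℝ => Real.log (V (Real.exp s)) / s) atTop (𝓝 γ) := by
    have hlow : Tendsto (fun s : ℝ => u ⌊s⌋₊ / (⌊s⌋₊ : ℕ) * ((⌊s⌋₊ : ℝ) / s)) atTop (𝓝 (γ * 1)) :=
      (hces.comp tendsto_nat_floor_atTop).mul tendsto_nat_floor_div_atTop
    have hup : Tendsto (fun s : ℝ => u ⌈s⌉₊ / (⌈s⌉₊ : ℕ) * ((⌈s⌉₊ : ℝ) / s)) atTop (𝓝 (γ * 1)) :=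
      (hces.comp tendsto_nat_ceil_atTop).mul tendsto_nat_ceil_div_atTop
    rw [mul_one] at hlow hup
    have hfl : Tendsto (fun s : ℝ => Real.exp (⌊s⌋₊ : ℝ)) atTop atTop :=
      hexp.comp tendsto_nat_floor_atTop
    refine tendsto_of_tendsto_of_tendsto_of_le_of_le' hlow hup ?_ ?_
    · filter_upwards [hfl.eventually hpos, eventually_ge_atTop 1] with s hs hs1
      have hf : (0 : ℝ) < (⌊s⌋₊ : ℝ) := by exact_mod_cast Nat.floor_pos.2 hs1
      rw [div_mul_div_cancel₀ hf.ne']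
      have hs0 : 0 < s := by linarith
      refine div_le_div_of_nonneg_right (Real.log_le_log hs ?_) hs0.le
      exact hmono (Real.exp_pos _) (Real.exp_pos _) (Real.exp_le_exp.2 (Nat.floor_le hs0.le))
    · filter_upwards [Real.tendsto_exp_atTop.eventually hpos, eventually_ge_atTop 1] with s hs hs1
      have hs0 : 0 < s := by linarith
      have hf : (0 : ℝ) < (⌈s⌉₊ : ℝ) := by exact_mod_cast Nat.ceil_pos.2 hs0
      rw [div_mul_div_cancel₀ hf.ne']
      refine div_le_div_of_nonneg_right (Real.log_le_log hs ?_) hs0.le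
      exact hmono (Real.exp_pos _) (Real.exp_pos _) (Real.exp_le_exp.2 (Nat.le_ceil s))
  refine (key.comp Real.tendsto_log_atTop).congr' ?_
  filter_upwards [eventually_gt_atTop 0] with t ht
  simp [Function.comp, Real.exp_log ht]

/-! ### Tail and moment estimates -/

section Tail

variable {ν : Measure ℝ} {γ : ℝ}

theorem tendsto_log_quantileV_rpow (hV : RegularlyVarying (quantileV (fun x => cdf ν x)) γ)
    {c : ℝ} (hc : 0 < c) :
    Tendsto (fun x : ℝ => Real.log (quantileV (fun x => cdf ν x) (x ^ c)) / Real.log x)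
      atTop (𝓝 (γ * c)) := by
  have h1 := (hV.tendsto_log_div_log (quantileV_monotoneOn ν) (quantileV_nonneg _)).comp
    (tendsto_rpow_atTop hc)
  refine (h1.mul_const c).congr' ?_
  filter_upwards [eventually_gt_atTop 1] with x hx
  have hx0 : Real.log x ≠ 0 := (Real.log_pos hx).ne'
  simp only [Function.comp]
  rw [Real.log_rpow (by linarith)]
  field_simp

/-- Since `V(x^b) = x^(γb + o(1)) < x`, the quantile bound gives `F(x) ≥ exp(-x^(-b)) ≥ 1 - x^(-b)`.
-/
theorem eventually_one_sub_rpow_le_cdf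
    (hV : RegularlyVarying (quantileV (fun x => cdf ν x)) γ)
    {b : ℝ} (hb : 0 < b) (hbγ : γ * b < 1) : ∀ᶠ x : ℝ in atTop, 1 - x ^ (-b) ≤ cdf ν x := by
  filter_upwards [(tendsto_log_quantileV_rpow hV hb).eventually (gt_mem_nhds hbγ),
    eventually_gt_atTop 1] with x hx hx1
  have hx0 : 0 < x := by linarith
  rw [div_lt_one (Real.log_pos hx1)] at hx
  have hlt : quantileV (fun x => cdf ν x) (x ^ b) < x := by
    rcases eq_or_lt_of_le (quantileV_nonneg (fun x => cdf ν x) (x ^ b)) with h | h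
    · rw [← h]; exact hx0
    · exact (Real.log_lt_log_iff h hx0).1 hx
  refine le_trans ?_ (exp_le_cdf_of_quantileV_lt ν (Real.rpow_pos_of_pos hx0 b) hlt)
  have h := Real.add_one_le_exp (-1 / x ^ b)
  rw [Real.rpow_neg hx0.le]
  have h2 : -1 / x ^ b = -(x ^ b)⁻¹ := by rw [neg_div, one_div]
  linarith

/-- For `c < 1` with `β < γc`, eventually `n^β < V(n^c)`, so `F(n^β)^n ≤ exp(-n^(1-c))`. -/
theorem tendsto_cdf_rpow_pow
    (hV : RegularlyVarying (quantileV (fun x => cdf ν x)) γ) (hγ : 0 < γ)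
    {β : ℝ} (hβ : β < γ) :
    Tendsto (fun n : ℕ => cdf ν ((n : ℝ) ^ β) ^ n) atTop (𝓝 0) := by
  -- The maximum with `0` keeps `c` positive when `β ≤ 0`.
  obtain ⟨c, hc, hc1⟩ : ∃ c, max 0 (β / γ) < c ∧ c < 1 :=
    exists_between (max_lt one_pos ((div_lt_one hγ).2 hβ))
  have hc0 : 0 < c := (le_max_left _ _).trans_lt hc
  have hcβ : β < γ * c := by
    have := (le_max_right _ _).trans_lt hc
    rwa [div_lt_iff₀ hγ, mul_comm] at this
  have hev : ∀ᶠ x : ℝ in atTop, cdf ν (x ^ β) ≤ Real.exp (-1 / x ^ c) := by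
    filter_upwards [(tendsto_log_quantileV_rpow hV hc0).eventually (lt_mem_nhds hcβ),
      -- This second bound excludes `V(x^c) = 0`, where `Real.log 0 = 0` could satisfy the first one
      -- for negative `β`.
      (tendsto_log_quantileV_rpow hV hc0).eventually
        (lt_mem_nhds (show 0 < γ * c by positivity)), eventually_gt_atTop 1] with x hx hx' hx1
    have hx0 : 0 < x := by linarith
    have hlog := Real.log_pos hx1
    rw [lt_div_iff₀ hlog, ← Real.log_rpow hx0] at hx
    have hV0 : 0 < quantileV (fun x => cdf ν x) (x ^ c) := by
      refine lt_of_le_of_ne (quantileV_nonneg _ _) fun h => ?_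
      rw [← h, Real.log_zero, zero_div] at hx'
      exact lt_irrefl _ hx'
    have hlt := (Real.log_lt_log_iff (Real.rpow_pos_of_pos hx0 β) hV0).1 hx
    exact (cdf_lt_of_lt_quantileV ν (Real.rpow_pos_of_pos hx0 c)
      (Real.rpow_pos_of_pos hx0 β).le hlt).le
  have hlim : Tendsto (fun n : ℕ => Real.exp (-((n : ℝ) ^ (1 - c)))) atTop (𝓝 0) :=
    Real.tendsto_exp_neg_atTop_nhds_zero.comp
      ((tendsto_rpow_atTop (by linarith)).comp tendsto_natCast_atTop_atTop)
  refine squeeze_zero' (Eventually.of_forall fun n => pow_nonneg (cdf_nonneg ν _) n) ?_ hlim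
  filter_upwards [tendsto_natCast_atTop_atTop.eventually hev, eventually_gt_atTop 0] with n hn hn0
  have hn' : (0 : ℝ) < n := by exact_mod_cast hn0
  refine (pow_le_pow_left₀ (cdf_nonneg ν _) hn n).trans_eq ?_
  rw [← Real.exp_nat_mul, Real.rpow_sub hn', Real.rpow_one]
  congr 1
  ring

/-- Layer-cake formula with `a < b < 1 / γ`: the tail is at most `1` near zero and at most `t^(-b)`
far out, where `t^(a-1-b)` is integrable. -/
theorem integrable_rpow_of_regularlyVarying [IsProbabilityMeasure ν]
    (hV : RegularlyVarying (quantileV (fun x => cdf ν x)) γ) (hν : ∀ᵐ x ∂ν, 0 ≤ x)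
    {a : ℝ} (ha : 0 < a) (haγ : γ * a < 1) (hγ : 0 < γ) : Integrable (fun x : ℝ => x ^ a) ν := by
  obtain ⟨b, hab, hb⟩ : ∃ b, a < b ∧ b < 1 / γ :=
    exists_between ((lt_div_iff₀ hγ).2 (by linarith))
  have hb0 : 0 < b := ha.trans hab
  obtain ⟨x₀, hx₀⟩ := eventually_atTop.1
    ((eventually_one_sub_rpow_le_cdf hV hb0 (by rwa [lt_div_iff₀ hγ, mul_comm] at hb)).and
      (eventually_gt_atTop 0))
  have hx₀0 : 0 < x₀ := (hx₀ x₀ le_rfl).2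
  refine ⟨(measurable_id.pow_const a).aestronglyMeasurable, ?_⟩
  rw [hasFiniteIntegral_iff_ofReal (by filter_upwards [hν] with x hx using Real.rpow_nonneg hx a),
    lintegral_rpow_eq_lintegral_meas_lt_mul ν hν measurable_id.aemeasurable ha]
  refine ENNReal.mul_lt_top ENNReal.ofReal_lt_top ?_
  rw [← Set.Ioc_union_Ioi_eq_Ioi hx₀0.le]
  refine (lintegral_union_le _ _ _).trans_lt (ENNReal.add_lt_top.2 ⟨?_, ?_⟩)
  · have hI : IntegrableOn (fun t : ℝ => t ^ (a - 1)) (Set.Ioc 0 x₀) :=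
      (intervalIntegrable_iff_integrableOn_Ioc_of_le hx₀0.le).1
        (intervalIntegral.intervalIntegrable_rpow' (by linarith))
    refine lt_of_le_of_lt ?_ hI.lintegral_lt_top
    refine lintegral_mono fun t => ?_
    exact mul_le_of_le_one_left (by positivity) prob_le_one
  · have hI : IntegrableOn (fun t : ℝ => t ^ (a - 1 - b)) (Set.Ioi x₀) :=
      integrableOn_Ioi_rpow_of_lt (by linarith) hx₀0
    refine lt_of_le_of_lt ?_ hI.lintegral_lt_top
    refine setLIntegral_mono' measurableSet_Ioi fun t ht => ?_
    have ht0 : 0 < t := hx₀0.trans ht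
    have h1 : ν {x | t < x} ≤ ENNReal.ofReal (t ^ (-b)) := by
      have hcompl : {x : ℝ | t < x} = (Set.Iic t)ᶜ := by ext; simp
      rw [hcompl, prob_compl_eq_one_sub measurableSet_Iic, ← ofReal_cdf,
        ← ENNReal.ofReal_one, ← ENNReal.ofReal_sub _ (cdf_nonneg ν t)]
      refine ENNReal.ofReal_le_ofReal ?_
      linarith [(hx₀ t (le_of_lt ht)).1]
    refine (mul_le_mul_left h1 _).trans_eq ?_
    rw [← ENNReal.ofReal_mul (Real.rpow_nonneg ht0.le _), ← Real.rpow_add ht0]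
    congr 2
    ring

theorem integrable_log_neg_of_bounded_density {p : ℝ → ℝ} (hp : Measurable p) {C : ℝ}
    (hC : ∀ x, p x ≤ C) :
    Integrable (fun x => max (-Real.log x) 0)
      (volume.withDensity (fun x => ENNReal.ofReal (p x))) := by
  have hm : Measurable (fun x : ℝ => max (-Real.log x) 0) :=
    Real.measurable_log.neg.max measurable_const
  refine ⟨hm.aestronglyMeasurable, ?_⟩
  rw [hasFiniteIntegral_iff_ofReal
      (Eventually.of_forall fun x => (le_max_right _ _ : (0 : ℝ) ≤ max (-Real.log x) 0)),
    lintegral_withDensity_eq_lintegral_mul _ hp.ennreal_ofReal hm.ennreal_ofReal]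
  -- `Real.log x` means `log |x|`, so the integrand vanishes off `(-1, 1]`, and the negative side
  -- need not be discarded.
  have hI : IntegrableOn (fun x : ℝ => max (-Real.log x) 0) (Set.Ioc (-1) 1) :=
    ((intervalIntegrable_iff_integrableOn_Ioc_of_le (by norm_num)).1
      intervalIntegral.intervalIntegrable_log').neg.pos_part
  have hsub : ∀ x : ℝ, (fun x => ENNReal.ofReal (p x)) x * ENNReal.ofReal (max (-Real.log x) 0) ≤
      (Set.Ioc (-1 : ℝ) 1).indicator
        (fun x => ENNReal.ofReal C * ENNReal.ofReal (max (-Real.log x) 0)) x := by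
    intro x
    by_cases hx : x ∈ Set.Ioc (-1 : ℝ) 1
    · rw [Set.indicator_of_mem hx]
      exact mul_le_mul_left (ENNReal.ofReal_le_ofReal (hC x)) _
    · have h1 : 1 ≤ |x| := by
        rw [Set.mem_Ioc, not_and_or, not_lt, not_le] at hx
        rcases hx with hx | hx
        · exact le_abs.2 (Or.inr (by linarith))
        · exact le_abs.2 (Or.inl hx.le)
      have h2 : 0 ≤ Real.log x := by rw [← Real.log_abs]; exact Real.log_nonneg h1
      simp [max_eq_right (neg_nonpos.2 h2)]
  refine lt_of_le_of_lt (lintegral_mono hsub) ?_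
  rw [lintegral_indicator measurableSet_Ioc, lintegral_const_mul _ hm.ennreal_ofReal]
  exact ENNReal.mul_lt_top ENNReal.ofReal_lt_top hI.lintegral_lt_top

end Tail

/-- Pathwise form of the `L¹` bound: `y` is the block statistic, `z` one observation, `T` the sum of
powers, `I` the indicator of an atypically small maximum. The upper half applies `log u ≤ u^a / a`
to `u = y / n^(γ+ε)` with `a = 1 / (γ+ε)`, for which `u^a = y^a / n`. -/
theorem abs_log_div_sub_le {y z T I L γ ε : ℝ} {n : ℕ} (hn : 0 < n) (hL : L = Real.log n)
    (hL0 : 0 < L) (hγ : 0 < γ) (hε : 0 < ε) (hz : 0 < z) (hzy : z ≤ y)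
    (hT : y ^ (1 / (γ + ε)) ≤ T) (hI0 : 0 ≤ I) (hI : y ≤ (n : ℝ) ^ (γ - ε) → 1 ≤ I) :
    |Real.log y / L - γ| ≤
      ε + (γ + ε) / L * (1 / n * T) + γ * I + max (-Real.log z) 0 / L := by
  have hn' : (0 : ℝ) < n := by exact_mod_cast hn
  have hy : 0 < y := hz.trans_le hzy
  have hg : 0 < γ + ε := by linarith
  have hT0 : 0 ≤ T := (Real.rpow_nonneg hy.le _).trans hT
  have h2 : 0 ≤ (γ + ε) / L * (1 / n * T) := by positivity
  have h3 : 0 ≤ γ * I := by positivity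
  have h4 : 0 ≤ max (-Real.log z) 0 / L := div_nonneg (le_max_right _ _) hL0.le
  rw [abs_le]
  constructor
  · by_cases hsmall : y ≤ (n : ℝ) ^ (γ - ε)
    · have h5 : γ ≤ γ * I := le_mul_of_one_le_right hγ.le (hI hsmall)
      have h6 : -(Real.log y / L) ≤ max (-Real.log z) 0 / L := by
        rw [← neg_div]
        refine div_le_div_of_nonneg_right (le_trans ?_ (le_max_left _ _)) hL0.le
        exact neg_le_neg (Real.log_le_log hz hzy)
      linarith
    · have h5 : (γ - ε) * L ≤ Real.log y := by
        rw [hL, ← Real.log_rpow hn']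
        exact Real.log_le_log (Real.rpow_pos_of_pos hn' _) (not_le.1 hsmall).le
      rw [← le_div_iff₀ hL0] at h5
      linarith
  · have hq : 0 < (n : ℝ) ^ (γ + ε) := Real.rpow_pos_of_pos hn' _
    have h5 := Real.log_le_rpow_div (div_pos hy hq).le (one_div_pos.2 hg)
    rw [Real.log_div hy.ne' hq.ne', Real.log_rpow hn', Real.div_rpow hy.le hq.le,
      ← Real.rpow_mul hn'.le, mul_one_div_cancel hg.ne', Real.rpow_one, ← hL] at h5
    have h6 : y ^ (1 / (γ + ε)) / n / (1 / (γ + ε)) ≤ (γ + ε) * (1 / n * T) := by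
      have : y ^ (1 / (γ + ε)) / n / (1 / (γ + ε)) =
          (γ + ε) * (1 / n * y ^ (1 / (γ + ε))) := by field_simp
      rw [this]
      gcongr
    have h7 : Real.log y / L ≤ (γ + ε) + (γ + ε) / L * (1 / n * T) := by
      rw [div_le_iff₀ hL0, add_mul]
      have : (γ + ε) / L * (1 / n * T) * L = (γ + ε) * (1 / n * T) := by field_simp
      rw [this]
      linarith
    linarith

/-! ### `L¹` convergence of block statistics -/

section Probability

variable {Ω : Type*} [MeasurableSpace Ω] {μ : Measure Ω}

theorem eLpNorm_one_le_ofReal_integral {f g : Ω → ℝ} (hg : Integrable g μ)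
    (h : ∀ᵐ ω ∂μ, |f ω| ≤ g ω) : eLpNorm f 1 μ ≤ ENNReal.ofReal (∫ ω, g ω ∂μ) := by
  rw [eLpNorm_one_eq_lintegral_enorm, ofReal_integral_eq_lintegral_ofReal hg
    (by filter_upwards [h] with ω hω using (abs_nonneg _).trans hω)]
  refine lintegral_mono_ae ?_
  filter_upwards [h] with ω hω
  rw [← ofReal_norm, Real.norm_eq_abs]
  exact ENNReal.ofReal_le_ofReal hω

theorem eLpNorm_average_sub_const_le {p : ENNReal} (hp : 1 ≤ p) {f : ℕ → Ω → ℝ} {c : ℝ}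
    {K : ℕ} (hK : 0 < K) {η : ENNReal} (hf : ∀ i, AEStronglyMeasurable (f i) μ)
    (h : ∀ i, eLpNorm (fun ω => f i ω - c) p μ ≤ η) :
    eLpNorm (fun ω => 1 / (K : ℝ) * ∑ i ∈ Finset.range K, f i ω - c) p μ ≤ η := by
  have hK' : (K : ℝ) ≠ 0 := by exact_mod_cast hK.ne'
  have heq : (fun ω => 1 / (K : ℝ) * ∑ i ∈ Finset.range K, f i ω - c) =
      (1 / (K : ℝ)) • ∑ i ∈ Finset.range K, fun ω => f i ω - c := by
    funext ω
    simp only [Pi.smul_apply, Finset.sum_apply, smul_eq_mul, Finset.sum_sub_distrib,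
      Finset.sum_const, Finset.card_range, nsmul_eq_mul]
    field_simp
  rw [heq, eLpNorm_const_smul]
  have hsum : eLpNorm (∑ i ∈ Finset.range K, fun ω => f i ω - c) p μ ≤ K * η := by
    refine (eLpNorm_sum_le (fun i _ => (hf i).sub aestronglyMeasurable_const) hp).trans ?_
    refine (Finset.sum_le_sum fun i _ => h i).trans_eq ?_
    simp
  refine (mul_le_mul_right hsum _).trans_eq ?_
  rw [← mul_assoc, one_div, enorm_inv hK', Real.enorm_natCast,
    ENNReal.inv_mul_cancel (by exact_mod_cast hK.ne') (ENNReal.natCast_ne_top K), one_mul]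

variable [IsProbabilityMeasure μ] {X : ℕ → Ω → ℝ}

theorem measure_forall_le_eq_cdf_pow (hmeas : ∀ k, Measurable (X k)) (hindep : iIndepFun X μ)
    (hident : ∀ k, IdentDistrib (X k) (X 0) μ μ) (s n : ℕ) (x : ℝ) :
    μ.real {ω | ∀ j < n, X (s + j) ω ≤ x} = cdf (μ.map (X 0)) x ^ n := by
  have hprob : IsProbabilityMeasure (μ.map (X 0)) :=
    Measure.isProbabilityMeasure_map (hmeas 0).aemeasurable
  have hset : {ω | ∀ j < n, X (s + j) ω ≤ x} =
      ⋂ j ∈ Finset.range n, X (s + j) ⁻¹' Set.Iic x := by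
    ext ω; simp
  have hind := (hindep.precomp (add_right_injective s)).measure_inter_preimage_eq_mul
    (Finset.range n) (sets := fun _ => Set.Iic x) (fun _ _ => measurableSet_Iic)
  rw [measureReal_def, hset, hind]
  have heach : ∀ j ∈ Finset.range n, μ (X (s + j) ⁻¹' Set.Iic x) =
      ENNReal.ofReal (cdf (μ.map (X 0)) x) := by
    intro j _
    rw [(hident (s + j)).measure_preimage_eq measurableSet_Iic, ofReal_cdf,
      Measure.map_apply (hmeas 0) measurableSet_Iic]
  rw [Finset.prod_congr rfl heach, Finset.prod_const, Finset.card_range, ENNReal.toReal_pow,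
    ENNReal.toReal_ofReal (cdf_nonneg _ _)]

/-- If a block statistic `Y x s n` of the observations `x s, …, x (s + n - 1)` lies between their
maximum and their `ℓ^a`-norms, `a < 1 / γ`, then `log (Y x s n) / log n` tends to `γ` in `L¹`,
uniformly in the starting point of the block. -/
theorem eventually_eLpNorm_log_div_log_sub_le (hmeas : ∀ k, Measurable (X k))
    (hindep : iIndepFun X μ) (hident : ∀ k, IdentDistrib (X k) (X 0) μ μ)
    (hpos : ∀ k, ∀ᵐ ω ∂μ, 0 < X k ω) {γ : ℝ} (hγ : 0 < γ)
    (hV : RegularlyVarying (quantileV (fun x => cdf (μ.map (X 0)) x)) γ)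
    (hlog : Integrable (fun x => max (-Real.log x) 0) (μ.map (X 0)))
    {Y : (ℕ → ℝ) → ℕ → ℕ → ℝ}
    (hYge : ∀ x : ℕ → ℝ, (∀ k, 0 < x k) → ∀ s n, ∀ j < n, x (s + j) ≤ Y x s n)
    (hYle : ∀ x : ℕ → ℝ, (∀ k, 0 < x k) → ∀ a, 0 < a → γ * a < 1 → ∀ s n, 0 < n →
      Y x s n ^ a ≤ ∑ j ∈ Finset.range n, x (s + j) ^ a)
    {η : ℝ} (hη : 0 < η) :
    ∀ᶠ n : ℕ in atTop, ∀ s,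
      eLpNorm (fun ω => Real.log (Y (fun k => X k ω) s n) / Real.log n - γ) 1 μ ≤
        ENNReal.ofReal η := by
  have hprob : IsProbabilityMeasure (μ.map (X 0)) :=
    Measure.isProbabilityMeasure_map (hmeas 0).aemeasurable
  -- The error bound below tends to `ε`, hence is eventually less than `η`.
  obtain ⟨ε, hεdef⟩ : ∃ ε, ε = η / 2 := ⟨_, rfl⟩
  have hε : 0 < ε := by linarith
  have hg : 0 < γ + ε := by linarith
  set a : ℝ := 1 / (γ + ε) with hadef
  have ha : 0 < a := by positivity
  have haγ : γ * a < 1 := by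
    rw [hadef, mul_one_div, div_lt_one hg]; linarith
  have hνnonneg : ∀ᵐ x ∂(μ.map (X 0)), 0 ≤ x := by
    rw [ae_map_iff (hmeas 0).aemeasurable measurableSet_Ici]
    filter_upwards [hpos 0] with ω hω using hω.le
  have hint0 : Integrable (fun x : ℝ => x ^ a) (μ.map (X 0)) :=
    integrable_rpow_of_regularlyVarying hV hνnonneg ha haγ hγ
  have hint : ∀ k, Integrable (fun ω => X k ω ^ a) μ := fun k =>
    ((hident k).comp (measurable_id.pow_const a)).integrable_iff.2
      (hint0.comp_measurable (hmeas 0))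
  set A : ℝ := ∫ ω, X 0 ω ^ a ∂μ with hA
  have hintA : ∀ k, ∫ ω, X k ω ^ a ∂μ = A := fun k =>
    ((hident k).comp (measurable_id.pow_const a)).integral_eq
  have hlogm : Measurable (fun x : ℝ => max (-Real.log x) 0) :=
    Real.measurable_log.neg.max measurable_const
  have hlogint : ∀ k, Integrable (fun ω => max (-Real.log (X k ω)) 0) μ := fun k =>
    ((hident k).comp hlogm).integrable_iff.2 (hlog.comp_measurable (hmeas 0))
  set B : ℝ := ∫ ω, max (-Real.log (X 0 ω)) 0 ∂μ with hB
  have hintB : ∀ k, ∫ ω, max (-Real.log (X k ω)) 0 ∂μ = B := fun k =>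
    ((hident k).comp hlogm).integral_eq
  have hLtop : Tendsto (fun n : ℕ => Real.log n) atTop atTop :=
    Real.tendsto_log_atTop.comp tendsto_natCast_atTop_atTop
  have hlim : Tendsto (fun n : ℕ => ε + (γ + ε) / Real.log n * A +
      γ * cdf (μ.map (X 0)) ((n : ℝ) ^ (γ - ε)) ^ n + B / Real.log n) atTop
      (𝓝 (ε + 0 * A + γ * 0 + 0)) :=
    (((tendsto_const_nhds.add ((hLtop.const_div_atTop _).mul_const A)).add
      ((tendsto_cdf_rpow_pow hV hγ (by linarith)).const_mul γ))).add (hLtop.const_div_atTop B)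
  have hlt : ε + 0 * A + γ * 0 + 0 < η := by rw [hεdef]; linarith
  filter_upwards [hlim.eventually (gt_mem_nhds hlt), eventually_ge_atTop 2] with n hn hn2 s
  have hn0 : 0 < n := by omega
  have hn0' : (n : ℝ) ≠ 0 := by exact_mod_cast hn0.ne'
  have hL0 : 0 < Real.log n := Real.log_pos (by exact_mod_cast hn2)
  -- `E` contains the event `Y ≤ n^(γ-ε)`, as `Y` dominates the maximum, and has probability
  -- `F(n^(γ-ε))^n`.
  set E : Set Ω := {ω | ∀ j < n, X (s + j) ω ≤ (n : ℝ) ^ (γ - ε)} with hE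
  have hEm : MeasurableSet E := by
    have : E = ⋂ j, ⋂ (_ : j < n), X (s + j) ⁻¹' Set.Iic ((n : ℝ) ^ (γ - ε)) := by
      ext ω; simp [hE]
    rw [this]
    exact MeasurableSet.iInter fun j => MeasurableSet.iInter fun _ =>
      hmeas (s + j) measurableSet_Iic
  have hi1 : Integrable (fun _ : Ω => ε) μ := integrable_const ε
  have hi2 : Integrable (fun ω => (γ + ε) / Real.log n *
      (1 / n * ∑ j ∈ Finset.range n, X (s + j) ω ^ a)) μ :=
    ((integrable_finsetSum _ fun j _ => hint (s + j)).const_mul _).const_mul _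
  have hi3 : Integrable (fun ω => γ * E.indicator (1 : Ω → ℝ) ω) μ :=
    ((integrable_const (1 : ℝ)).indicator hEm).const_mul γ
  have hi4 : Integrable (fun ω => max (-Real.log (X s ω)) 0 / Real.log n) μ :=
    (hlogint s).div_const _
  have hbound := eLpNorm_one_le_ofReal_integral (((hi1.add hi2).add hi3).add hi4)
    (f := fun ω => Real.log (Y (fun k => X k ω) s n) / Real.log n - γ) (by
      filter_upwards [ae_all_iff.2 hpos] with ω hω
      refine abs_log_div_sub_le hn0 rfl hL0 hγ hε (hω s)
        (hYge (fun k => X k ω) hω s n 0 hn0) (hYle (fun k => X k ω) hω a ha haγ s n hn0)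
        (Set.indicator_nonneg (fun _ _ => zero_le_one) _) fun hy => ?_
      rw [Set.indicator_of_mem]
      · exact le_rfl
      · exact fun j hj => (hYge (fun k => X k ω) hω s n j hj).trans hy)
  refine hbound.trans (ENNReal.ofReal_le_ofReal (le_trans (le_of_eq ?_) hn.le))
  rw [integral_add' ((hi1.add hi2).add hi3) hi4, integral_add' (hi1.add hi2) hi3,
    integral_add' hi1 hi2, integral_const_mul, integral_const_mul, integral_const_mul,
    integral_finsetSum _ (fun j _ => hint (s + j)), integral_div, integral_indicator_one hEm,
    measure_forall_le_eq_cdf_pow hmeas hindep hident, hintB]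
  simp only [hintA, integral_const, probReal_univ, one_smul, Finset.sum_const, Finset.card_range,
    nsmul_eq_mul]
  congr 3
  field_simp

/-- The block statistics `log (Y x s n)` recover the index `γ` from their growth between
blocks of width `m` and `m ^ 2`. -/
theorem tendstoInMeasure_average_log_block (hmeas : ∀ k, Measurable (X k))
    (hindep : iIndepFun X μ) (hident : ∀ k, IdentDistrib (X k) (X 0) μ μ)
    (hpos : ∀ k, ∀ᵐ ω ∂μ, 0 < X k ω) {γ : ℝ} (hγ : 0 < γ)
    (hV : RegularlyVarying (quantileV (fun x => cdf (μ.map (X 0)) x)) γ)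
    (hlog : Integrable (fun x => max (-Real.log x) 0) (μ.map (X 0)))
    {Y : (ℕ → ℝ) → ℕ → ℕ → ℝ}
    (hYmeas : ∀ s n, Measurable fun ω => Y (fun k => X k ω) s n)
    (hYge : ∀ x : ℕ → ℝ, (∀ k, 0 < x k) → ∀ s n, ∀ j < n, x (s + j) ≤ Y x s n)
    (hYle : ∀ x : ℕ → ℝ, (∀ k, 0 < x k) → ∀ a, 0 < a → γ * a < 1 → ∀ s n, 0 < n →
      Y x s n ^ a ≤ ∑ j ∈ Finset.range n, x (s + j) ^ a)
    {m : ℕ → ℕ} (hm : Tendsto m atTop atTop) (hblock : ∀ᶠ N : ℕ in atTop, 1 ≤ N / m N ^ 2) :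
    TendstoInMeasure μ
      (fun (N : ℕ) (ω : Ω) => 1 / ((N / m N ^ 2 : ℕ) : ℝ) * ∑ i ∈ Finset.range (N / m N ^ 2),
        (Real.log (Y (fun k => X k ω) (i * m N ^ 2) (m N ^ 2)) / Real.log (m N)
          - 1 / (m N : ℝ) * ∑ k ∈ Finset.range (m N),
              Real.log (Y (fun k => X k ω) (i * m N ^ 2 + k * m N) (m N)) / Real.log (m N)))
      atTop (fun _ => γ) := by
  have hlogmeas : ∀ s n c, Measurable fun ω => Real.log (Y (fun k => X k ω) s n) / c :=
    fun s n c => (hYmeas s n).log.div_const c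
  have hsub : ∀ i M : ℕ, Measurable fun ω => 1 / (M : ℝ) * ∑ k ∈ Finset.range M,
      Real.log (Y (fun k => X k ω) (i * M ^ 2 + k * M) M) / Real.log M := fun i M =>
    (Finset.measurable_fun_sum _ fun k _ => hlogmeas _ _ _).const_mul _
  have hxi : ∀ i M : ℕ, Measurable fun ω =>
      Real.log (Y (fun k => X k ω) (i * M ^ 2) (M ^ 2)) / Real.log M
        - 1 / (M : ℝ) * ∑ k ∈ Finset.range M,
            Real.log (Y (fun k => X k ω) (i * M ^ 2 + k * M) M) / Real.log M := fun i M =>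
    (hlogmeas _ _ _).sub (hsub i M)
  refine tendstoInMeasure_of_tendsto_eLpNorm one_ne_zero (fun N =>
    ((Finset.measurable_fun_sum _ fun i _ => hxi i (m N)).const_mul _).aestronglyMeasurable)
    aestronglyMeasurable_const ?_
  refine ENNReal.tendsto_nhds_zero.2 fun δ hδ => ?_
  -- Factor `3`: the large block costs `2η`, the sub-blocks `η`.
  obtain ⟨η, hη, hηδ⟩ : ∃ η : ℝ, 0 < η ∧ 3 * ENNReal.ofReal η ≤ δ := by
    obtain ⟨r, hr0, hr⟩ := ENNReal.lt_iff_exists_nnreal_btwn.1 hδ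
    refine ⟨r / 3, div_pos (by exact_mod_cast hr0) (by norm_num), le_trans (le_of_eq ?_) hr.le⟩
    rw [show (3 : ENNReal) = ENNReal.ofReal 3 by simp, ← ENNReal.ofReal_mul (by norm_num),
      mul_div_cancel₀ _ (by norm_num), ENNReal.ofReal_coe_nnreal]
  have hL1 := eventually_eLpNorm_log_div_log_sub_le hmeas hindep hident hpos hγ hV hlog hYge hYle hη
  have hm2 : Tendsto (fun N => m N ^ 2) atTop atTop := (tendsto_pow_atTop two_ne_zero).comp hm
  filter_upwards [hm.eventually hL1, hm2.eventually hL1, hm.eventually (eventually_ge_atTop 2),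
    hblock] with N h1 h2 hM hN
  refine le_trans (eLpNorm_average_sub_const_le le_rfl hN
    (fun i => (hxi i (m N)).aestronglyMeasurable) fun i => ?_) hηδ
  set M := m N with hMdef
  have hM0 : 0 < M := by omega
  have hL0 : Real.log M ≠ 0 := (Real.log_pos (by exact_mod_cast hM)).ne'
  -- As `log (M^2) = 2 log M`, dividing by `log M` doubles both the limit and the error.
  have hbig : eLpNorm (fun ω => Real.log (Y (fun k => X k ω) (i * M ^ 2) (M ^ 2)) / Real.log M
      - 2 * γ) 1 μ ≤ 2 * ENNReal.ofReal η := by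
    have heq : (fun ω => Real.log (Y (fun k => X k ω) (i * M ^ 2) (M ^ 2)) / Real.log M - 2 * γ) =
        (2 : ℝ) • fun ω => Real.log (Y (fun k => X k ω) (i * M ^ 2) (M ^ 2)) /
          Real.log ((M ^ 2 : ℕ) : ℝ) - γ := by
      funext ω
      simp only [Pi.smul_apply, smul_eq_mul, Nat.cast_pow, Real.log_pow]
      push_cast
      field_simp
    rw [heq, eLpNorm_const_smul]
    refine (mul_le_mul_right (h2 _) _).trans_eq ?_
    congr 1
    rw [← ofReal_norm]
    norm_num
  have hsmall := eLpNorm_average_sub_const_le (μ := μ) (c := γ) le_rfl hM0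
    (fun k => (hlogmeas (i * M ^ 2 + k * M) M (Real.log M)).aestronglyMeasurable)
    (fun k => h1 (i * M ^ 2 + k * M))
  have hsplit : (fun ω => Real.log (Y (fun k => X k ω) (i * M ^ 2) (M ^ 2)) / Real.log M
        - 1 / (M : ℝ) * ∑ k ∈ Finset.range M,
            Real.log (Y (fun k => X k ω) (i * M ^ 2 + k * M) M) / Real.log M - γ) =
      (fun ω => Real.log (Y (fun k => X k ω) (i * M ^ 2) (M ^ 2)) / Real.log M - 2 * γ) -
      (fun ω => 1 / (M : ℝ) * ∑ k ∈ Finset.range M,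
            Real.log (Y (fun k => X k ω) (i * M ^ 2 + k * M) M) / Real.log M - γ) := by
    funext ω
    simp only [Pi.sub_apply]
    ring
  rw [hsplit]
  refine (eLpNorm_sub_le ((hlogmeas _ _ _).sub_const _).aestronglyMeasurable
    ((hsub i M).sub_const _).aestronglyMeasurable le_rfl).trans ?_
  refine (add_le_add hbig hsmall).trans_eq ?_
  rw [show (3 : ENNReal) = 2 + 1 by norm_num, add_mul, one_mul]

end Probability

/-! ### Maxima and Euclidean norms as block statistics -/

theorem le_blockMax (x : ℕ → ℝ) (s n j : ℕ) (hj : j < n) : x (s + j) ≤ blockMax x s n :=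
  le_ciSup (f := fun j : Fin n => x (s + j)) (Set.finite_range _).bddAbove ⟨j, hj⟩

theorem blockMax_rpow_le {x : ℕ → ℝ} (hx : ∀ k, 0 < x k) (a : ℝ) (s : ℕ) {n : ℕ}
    (hn : 0 < n) : blockMax x s n ^ a ≤ ∑ j ∈ Finset.range n, x (s + j) ^ a := by
  have : Nonempty (Fin n) := ⟨⟨0, hn⟩⟩
  obtain ⟨j, hj⟩ := exists_eq_ciSup_of_finite (f := fun j : Fin n => x (s + j))
  rw [blockMax, ← hj]
  exact Finset.single_le_sum (f := fun j => x (s + j) ^ a)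
    (fun _ _ => Real.rpow_nonneg (hx _).le a) (Finset.mem_range.2 j.2)

theorem le_sqrt_blockSumSq (x : ℕ → ℝ) (s n j : ℕ) (hj : j < n) :
    x (s + j) ≤ Real.sqrt (blockSumSq x s n) :=
  Real.le_sqrt_of_sq_le (Finset.single_le_sum (f := fun j => x (s + j) ^ 2)
    (fun _ _ => sq_nonneg _) (Finset.mem_range.2 hj))

/-- For `a ≤ 2` the function `y ↦ y^(a/2)` is subadditive on `[0, ∞)`; apply it to the squares. -/
theorem sqrt_blockSumSq_rpow_le {x : ℕ → ℝ} (hx : ∀ k, 0 < x k) {a : ℝ} (ha : 0 < a)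
    (ha2 : a ≤ 2) (s n : ℕ) :
    Real.sqrt (blockSumSq x s n) ^ a ≤ ∑ j ∈ Finset.range n, x (s + j) ^ a := by
  have hS : 0 ≤ blockSumSq x s n := Finset.sum_nonneg fun _ _ => sq_nonneg _
  rw [Real.sqrt_eq_rpow, ← Real.rpow_mul hS]
  refine (Finset.le_sum_of_subadditive_on_pred (fun y : ℝ => y ^ (1 / 2 * a)) (fun y => 0 ≤ y)
    (by rw [Real.zero_rpow (by positivity)])
    (fun _ _ hy hz => Real.rpow_add_le_add_rpow hy hz (by positivity) (by linarith))
    (fun _ _ hy hz => add_nonneg hy hz) _ fun _ _ => sq_nonneg _).trans_eq ?_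
  refine Finset.sum_congr rfl fun j _ => ?_
  rw [← Real.rpow_natCast, ← Real.rpow_mul (hx _).le]
  congr 1
  push_cast
  ring

end TailIndex

theorem theorem1 {Ω : Type*} [MeasurableSpace Ω] (μ : Measure Ω) [IsProbabilityMeasure μ]
    (X : ℕ → Ω → ℝ) (hmeas : ∀ k, Measurable (X k)) (hnonneg : ∀ k, ∀ᵐ ω ∂μ, 0 ≤ X k ω)
    (hindep : iIndepFun X μ) (hident : ∀ k, IdentDistrib (X k) (X 0) μ μ)
    (γ : ℝ)
    (hV : TailIndex.RegularlyVarying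
      (TailIndex.quantileV (fun x => cdf (μ.map (X 0)) x)) γ)
    (m : ℕ → ℕ) (hm : Tendsto m atTop atTop)
    (hrate : Tendsto (fun N : ℕ => (N : ℝ) * Real.log (m N) ^ 2 / (m N : ℝ) ^ 2) atTop atTop)
    (hblock : ∀ᶠ N : ℕ in atTop, 1 ≤ N / m N ^ 2) :
    (1 / 2 < γ → TailIndex.HasTameDensity (μ.map (X 0)) →
      TendstoInMeasure μ
        (fun (N : ℕ) (ω : Ω) => TailIndex.srcenEstimator (fun k => X k ω) N (m N))
        atTop (fun _ => γ)) ∧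
    (0 < γ → (∃ δ : ℝ, 0 < δ ∧ cdf (μ.map (X 0)) δ = 0) →
      TendstoInMeasure μ
        (fun (N : ℕ) (ω : Ω) => TailIndex.maxEstimator (fun k => X k ω) N (m N))
        atTop (fun _ => γ)) := by
  have hprob : IsProbabilityMeasure (μ.map (X 0)) :=
    Measure.isProbabilityMeasure_map (hmeas 0).aemeasurable
  constructor
  · rintro hγ ⟨p, hp, -, hdens, ⟨C, hC⟩, -⟩
    -- A law with a density has no atom at `0`, so the observations are almost surely positive.
    have hne : ∀ᵐ ω ∂μ, X 0 ω ≠ 0 := by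
      refine ae_of_ae_map (hmeas 0).aemeasurable (p := fun x : ℝ => x ≠ 0) ?_
      rw [hdens]
      exact (withDensity_absolutelyContinuous _ _).ae_le
        (compl_mem_ae_iff.2 (Real.volume_singleton (a := 0)))
    have hpos : ∀ k, ∀ᵐ ω ∂μ, 0 < X k ω := fun k => by
      filter_upwards [hnonneg k, (hident k).symm.ae_snd (p := fun x : ℝ => x ≠ 0)
        (measurableSet_singleton 0).compl hne] with ω h1 h2
      exact lt_of_le_of_ne h1 (Ne.symm h2)
    have hlog : Integrable (fun x => max (-Real.log x) 0) (μ.map (X 0)) := by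
      rw [hdens]
      exact TailIndex.integrable_log_neg_of_bounded_density hp hC
    have key := TailIndex.tendstoInMeasure_average_log_block hmeas hindep hident hpos
      (by linarith) hV hlog (Y := fun x s n => Real.sqrt (TailIndex.blockSumSq x s n))
      (fun s n => (Finset.measurable_fun_sum _ fun j _ => (hmeas (s + j)).pow_const 2).sqrt)
      (fun x _ s n j hj => TailIndex.le_sqrt_blockSumSq x s n j hj)
      -- Here `γ > 1/2` enters: `γ a < 1` forces `a < 2`.
      (fun x hx a ha haγ s n _ => TailIndex.sqrt_blockSumSq_rpow_le hx ha
        (by nlinarith) s n) hm hblock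
    have hsq : ∀ (x : ℕ → ℝ) (s n : ℕ) (c : ℝ),
        Real.log (Real.sqrt (TailIndex.blockSumSq x s n)) / c =
          Real.log (TailIndex.blockSumSq x s n) / (2 * c) := fun x s n c => by
      have hS : 0 ≤ TailIndex.blockSumSq x s n := Finset.sum_nonneg fun _ _ => sq_nonneg _
      rw [Real.log_sqrt hS, div_div]
    simp only [hsq] at key
    exact key
  · rintro hγ ⟨δ, hδ, hFδ⟩
    have hgt : ∀ᵐ ω ∂μ, δ < X 0 ω := by
      refine ae_of_ae_map (hmeas 0).aemeasurable (p := fun x : ℝ => δ < x) ?_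
      have h0 : μ.map (X 0) (Set.Iic δ) = 0 := by rw [← ofReal_cdf, hFδ, ENNReal.ofReal_zero]
      filter_upwards [compl_mem_ae_iff.2 h0] with x hx using not_le.1 hx
    have hpos : ∀ k, ∀ᵐ ω ∂μ, 0 < X k ω := fun k => by
      filter_upwards [(hident k).symm.ae_snd (p := fun x : ℝ => δ < x)
        measurableSet_Ioi hgt] with ω h
      exact hδ.trans h
    have hlogm : Measurable (fun x : ℝ => max (-Real.log x) 0) :=
      Real.measurable_log.neg.max measurable_const
    have hlog : Integrable (fun x => max (-Real.log x) 0) (μ.map (X 0)) := by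
      rw [integrable_map_measure hlogm.aestronglyMeasurable (hmeas 0).aemeasurable]
      refine Integrable.of_bound (hlogm.comp (hmeas 0)).aestronglyMeasurable
        (max (-Real.log δ) 0) ?_
      filter_upwards [hgt] with ω hω
      rw [Function.comp_apply, Real.norm_of_nonneg (le_max_right _ _)]
      exact max_le_max (neg_le_neg (Real.log_le_log hδ hω.le)) le_rfl
    exact TailIndex.tendstoInMeasure_average_log_block hmeas hindep hident hpos hγ hV hlog
      (Y := TailIndex.blockMax) (fun s n => Measurable.iSup fun j => hmeas (s + j))
      (fun x _ s n j hj => TailIndex.le_blockMax x s n j hj)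
      (fun x hx a _ _ s n hn => TailIndex.blockMax_rpow_le hx a s hn) hm hblock
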